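/- For $m\ge 1$ let $\mathbb G_m$ be the set of probability distributions $G=\sum_{j=1}^m\alpha_j\delta_{\theta_j}$ on $\mathbb R$ with $\alpha_j\ge 0$, $\sum_j\alpha_j=1$ and arbitrary (not necessarily distinct) $\theta_1,\dots,\theta_m\in\mathbb R$; we write $G(\theta)=\sum_j \alpha_j 1\{\theta_j\le\theta\}$ for its distribution function. For $G\in\mathbb G_m$ and $\sigma^2>0$ let $$f(x;G,\sigma^2)=\sum_{j=1}^m\alpha_j\,\frac{1}{\sqrt{2\pi\sigma^2}}\exp\Bigl\{-\frac{(x-\theta_j)^2}{2\sigma^2}\Bigr\},\qquad x\in\mathbb R,$$ be the density of the normal mixture of order $m$ with common variance $\sigma^2$. For observations $x_1,\dots,x_n$ let $\ell_n(G,\sigma^2)=\sum_{i=1}^n\log f(x_i;G,\sigma^2)$. A maximum likelihood estimate (MLE) is any pair $(\hat G,\hat\sigma^2)\in\mathbb G_m\times(0,\infty)$ that maximizes $\ell_n$ over $\mathbb G_m\times(0,\infty)$; in particular, the component means range over all of $\mathbb R$, not over a compact set. For distributions $G_1,G_2$ on $\mathbb R$ let $$D_{\mathrm{KW}}(G_1,G_2)=\int_{\mathbb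 R}|G_1(\theta)-G_2(\theta)|\,e^{-|\theta|}\,d\theta .$$ **Theorem.** Let $m\ge 1$ be known, let $G^*\in\mathbb G_m$ and $\sigma^{*2}>0$, and let $X_1,X_2,\dots$ be i.i.d. random variables with density $f(\cdot;G^*,\sigma^{*2})$. Then, almost surely, an MLE based on $X_1,\dots,X_n$ exists for every $n>m$. Moreover, the MLE is strongly consistent: if, almost surely, $(\hat G_n,\hat\sigma_n^2)$ is an MLE based on $X_1,\dots,X_n$ for all sufficiently large $n$, then, almost surely, $$D_{\mathrm{KW}}(\hat G_n,G^*)\to 0\quad\text{and}\quad \hat\sigma_n^2\to\sigma^{*2}\qquad\text{as } n\to\infty .$$ -/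

import Mathlib

open MeasureTheory ProbabilityTheory Filter Topology
open scoped NNReal

/-- The mixing distributions of order `m` on `ℝ`: the probability measures
`∑ j, α j • δ_{θ j}` with `m` (not necessarily distinct) support points `θ j` and mixing
proportions `α j ≥ 0`, some of which may vanish. -/
def mixingDistributions (m : ℕ) : Set (ProbabilityMeasure ℝ) :=
  {G | ∃ (α θ : Fin m → ℝ), (∀ j, 0 ≤ α j) ∧ ∑ j, α j = 1 ∧
    (G : Measure ℝ) = ∑ j, ENNReal.ofReal (α j) • Measure.dirac (θ j)}

/-- The density `f(x; G, v) = ∫ φ(x; θ, v) dG(θ)` at `x` of the normal mixture with mixing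
distribution `G` of the component means and common variance `v`. For `G = ∑ j, α j • δ_{θ j}`
it is `∑ j, α j * φ(x; θ j, v)`. -/
noncomputable def normalMixturePDF (G : ProbabilityMeasure ℝ) (v : ℝ≥0) (x : ℝ) : ℝ :=
  ∫ θ, gaussianPDFReal θ v x ∂(G : Measure ℝ)

/-- The distribution on `ℝ` with Lebesgue density `f(·; G, v)`. -/
noncomputable def normalMixture (G : ProbabilityMeasure ℝ) (v : ℝ≥0) : Measure ℝ :=
  volume.withDensity fun x => ENNReal.ofReal (normalMixturePDF G v x)

/-- The log-likelihood of `(G, v)` at the sample `x 0, …, x (n - 1)`. -/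
noncomputable def logLikelihood {n : ℕ} (x : Fin n → ℝ) (G : ProbabilityMeasure ℝ) (v : ℝ≥0) :
    ℝ :=
  ∑ i, Real.log (normalMixturePDF G v (x i))

/-- `(G, v)` is a maximum likelihood estimate from the sample `x` in the normal mixture model of
order `m` with unknown common variance: it maximizes the log-likelihood over all mixing
distributions of order `m` on the whole line and all positive variances. -/
def IsMLE (m : ℕ) {n : ℕ} (x : Fin n → ℝ) (G : ProbabilityMeasure ℝ) (v : ℝ≥0) : Prop :=
  G ∈ mixingDistributions m ∧ 0 < v ∧
    ∀ G' ∈ mixingDistributions m, ∀ v' : ℝ≥0, 0 < v' →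
      logLikelihood x G' v' ≤ logLikelihood x G v

/-- The Kiefer-Wolfowitz distance `∫ |G₁(θ) - G₂(θ)| exp(-|θ|) dθ` between two distributions on
`ℝ`, in terms of their cumulative distribution functions. -/
noncomputable def distKW (G₁ G₂ : ProbabilityMeasure ℝ) : ℝ :=
  ∫ θ, |cdf (G₁ : Measure ℝ) θ - cdf (G₂ : Measure ℝ) θ| * Real.exp (-|θ|)

/-!
The proof is Wald's consistency argument on a compactification of the parameter space.

*Existence.* Moving component means to the range of the observations increases every density value
`f(x i)`, so the means may be kept in a compact interval. Among more than `m` distinct observations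
one stays away from all `m` means (`exists_far_point`), which makes the log-likelihood tend to `-∞`
as the variance tends to `0`; it also does so as the variance tends to `∞`
(`sum_log_mixPDF_le`, `exists_variance_bounds`). A maximizer is then found by compactness
(`exists_isMLE`).

*Consistency.* The true density is bounded, so for a fine enough grid no cell contains more than a
small fraction of the observations, eventually and uniformly in the cell (`exists_grid_count_le`).
At least half of the observations thus keep a fixed distance from all means, wherever these are,
and the same bound as before confines the estimated variance to a fixed compact subinterval of
`(0, ∞)` (`ae_eventually_variance_mem_Icc`). With weights in the simplex, means in `[-∞, ∞]` and
variances in that interval, parameters range over a compact space, to which the density extends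
continuously if components with infinite mean are given density zero (`tendsto_mixPDF`).
For a density `f` with likelihood at least that of the truth `f₀`, concavity of the logarithm shows
that the criterion `log ((1 + f / f₀) / 2)` has a nonnegative sample average; the criterion has an
integrable envelope, so by the strong law for its suprema over a countable family of open sets, its
expectation is nonnegative at every limit point of the estimates (`ae_integral_nonneg_of_tendsto`).
By the equality case of Jensen's inequality the density at the limit point is `f₀`
(`mixPDF_ae_eq_of_integral_log_nonneg`), hence no mass has escaped to `±∞`, and since finite normal
mixtures are identifiable (`identifiable`) the limit point represents the true mixing distribution
and variance. The distance `distKW` is continuous at such points (`tendsto_distKW`).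
-/

/-! ### Finite normal mixtures -/

/-- The measure `∑ j, α j • δ_{θ j}`, for weights `α j ≥ 0` that need not sum to one. -/
noncomputable def discreteMeasure {m : ℕ} (α θ : Fin m → ℝ) : Measure ℝ :=
  ∑ j, ENNReal.ofReal (α j) • Measure.dirac (θ j)

/-- The normal mixture density `∑ j, α j * φ(x; θ j, v)` in terms of weights and means. -/
noncomputable def mixPDF {m : ℕ} (α θ : Fin m → ℝ) (v : ℝ≥0) (x : ℝ) : ℝ :=
  ∑ j, α j * gaussianPDFReal (θ j) v x

instance isFiniteMeasure_discreteMeasure {m : ℕ} (α θ : Fin m → ℝ) :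
    IsFiniteMeasure (discreteMeasure α θ) :=
  ⟨by simp [discreteMeasure, ENNReal.sum_lt_top]⟩

lemma discreteMeasure_univ {m : ℕ} {α : Fin m → ℝ} (hα : ∀ j, 0 ≤ α j) (θ : Fin m → ℝ) :
    discreteMeasure α θ Set.univ = ENNReal.ofReal (∑ j, α j) := by
  simp [discreteMeasure, ENNReal.ofReal_sum_of_nonneg fun j _ => hα j]

lemma integral_discreteMeasure {m : ℕ} {α : Fin m → ℝ} (hα : ∀ j, 0 ≤ α j) (θ : Fin m → ℝ)
    (f : ℝ → ℝ) : ∫ x, f x ∂(discreteMeasure α θ) = ∑ j, α j * f (θ j) := by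
  rw [discreteMeasure, integral_finsetSum_measure]
  · simp [integral_smul_measure, ENNReal.toReal_ofReal, hα]
  · intro j _
    exact (integrable_dirac (by simp)).smul_measure ENNReal.ofReal_ne_top

lemma normalMixturePDF_eq_mixPDF {m : ℕ} {α : Fin m → ℝ} (hα : ∀ j, 0 ≤ α j) (θ : Fin m → ℝ)
    {G : ProbabilityMeasure ℝ} (hG : (G : Measure ℝ) = discreteMeasure α θ) (v : ℝ≥0) (x : ℝ) :
    normalMixturePDF G v x = mixPDF α θ v x := by
  rw [normalMixturePDF, hG, integral_discreteMeasure hα]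
  rfl

lemma mixPDF_nonneg {m : ℕ} {α : Fin m → ℝ} (hα : ∀ j, 0 ≤ α j) (θ : Fin m → ℝ) (v : ℝ≥0)
    (x : ℝ) : 0 ≤ mixPDF α θ v x :=
  Finset.sum_nonneg fun j _ => mul_nonneg (hα j) (gaussianPDFReal_nonneg _ _ _)

lemma mixPDF_pos {m : ℕ} {α : Fin m → ℝ} (hα : α ∈ stdSimplex ℝ (Fin m)) (θ : Fin m → ℝ)
    {v : ℝ≥0} (hv : v ≠ 0) (x : ℝ) : 0 < mixPDF α θ v x := by
  obtain ⟨j, -, hj⟩ : ∃ j ∈ Finset.univ, (0 : ℝ) < α j :=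
    Finset.exists_lt_of_sum_lt (by simp [hα.2])
  exact Finset.sum_pos' (fun j _ => mul_nonneg (hα.1 j) (gaussianPDFReal_nonneg _ _ _))
    ⟨j, Finset.mem_univ j, mul_pos hj (gaussianPDFReal_pos _ _ _ hv)⟩

lemma continuous_gaussianPDFReal (θ : ℝ) (v : ℝ≥0) : Continuous (gaussianPDFReal θ v) := by
  unfold gaussianPDFReal
  fun_prop

lemma continuous_mixPDF {m : ℕ} (α θ : Fin m → ℝ) (v : ℝ≥0) : Continuous (mixPDF α θ v) :=
  continuous_finsetSum _ fun _ _ => continuous_const.mul (continuous_gaussianPDFReal _ _)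

lemma withDensity_mixPDF {m : ℕ} {α : Fin m → ℝ} (hα : ∀ j, 0 ≤ α j) (θ : Fin m → ℝ) {v : ℝ≥0}
    (hv : v ≠ 0) :
    volume.withDensity (fun x => ENNReal.ofReal (mixPDF α θ v x)) =
      ∑ j, ENNReal.ofReal (α j) • gaussianReal (θ j) v := by
  ext s hs
  rw [withDensity_apply _ hs]
  simp_rw [mixPDF, ENNReal.ofReal_sum_of_nonneg fun j _ =>
    mul_nonneg (hα j) (gaussianPDFReal_nonneg _ _ _), ENNReal.ofReal_mul (hα _)]
  rw [lintegral_finsetSum _ fun j _ =>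
    (measurable_gaussianPDFReal _ _).ennreal_ofReal.const_mul _]
  simp only [Measure.coe_finsetSum, Finset.sum_apply, Measure.smul_apply, smul_eq_mul]
  refine Finset.sum_congr rfl fun j _ => ?_
  rw [lintegral_const_mul _ (measurable_gaussianPDFReal _ _).ennreal_ofReal,
    gaussianReal_apply _ hv]
  rfl

lemma discreteMeasure_conv_gaussianReal {m : ℕ} (α θ : Fin m → ℝ) (v : ℝ≥0) :
    (discreteMeasure α θ).conv (gaussianReal 0 v) =
      ∑ j, ENNReal.ofReal (α j) • gaussianReal (θ j) v := by
  rw [discreteMeasure]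
  induction (Finset.univ : Finset (Fin m)) using Finset.induction_on with
  | empty => simp
  | insert j s hj ih =>
    have : IsFiniteMeasure (∑ i ∈ s, ENNReal.ofReal (α i) • Measure.dirac (θ i)) :=
      ⟨by simp [ENNReal.sum_lt_top]⟩
    rw [Finset.sum_insert hj, Finset.sum_insert hj, Measure.add_conv, ih,
      Measure.conv_smul_left, Measure.dirac_conv, gaussianReal_map_const_add, zero_add]

/-! ### Identifiability -/

lemma conv_gaussianReal_singleton (μ : Measure ℝ) [IsFiniteMeasure μ] {w : ℝ≥0} (hw : w ≠ 0)
    (x : ℝ) : μ.conv (gaussianReal 0 w) {x} = 0 := by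
  have := nullSingletonClass_gaussianReal (μ := 0) hw
  have h : ∀ y : ℝ, gaussianReal 0 w ((fun z => y + z) ⁻¹' {x}) = 0 := fun y => by
    have : (fun z => y + z) ⁻¹' {x} = {x - y} := by
      ext z
      simp only [Set.mem_preimage, Set.mem_singleton_iff]
      exact eq_sub_iff_add_eq'.symm
    rw [this, measure_singleton]
  rw [Measure.conv, Measure.map_apply (by fun_prop) (measurableSet_singleton x),
    Measure.prod_apply (by measurability)]
  exact (lintegral_congr h).trans lintegral_zero

/-- Dividing the characteristic functions by that of the normal distribution with the smaller
variance leaves `G = G' ∗ N(0, w)`, and the right-hand side has no atoms unless `w = 0`. -/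
lemma identifiable_of_le {m : ℕ} {α θ α' θ' : Fin m → ℝ} (hα : ∀ j, 0 ≤ α j)
    (hα' : α' ∈ stdSimplex ℝ (Fin m)) {v w : ℝ≥0}
    (h : (discreteMeasure α θ).conv (gaussianReal 0 v) =
      (discreteMeasure α' θ').conv (gaussianReal 0 (v + w))) :
    w = 0 ∧ discreteMeasure α θ = discreteMeasure α' θ' := by
  have key : discreteMeasure α θ = (discreteMeasure α' θ').conv (gaussianReal 0 w) := by
    refine Measure.ext_of_charFun (funext fun t => ?_)
    have ht := congrArg (fun μ => charFun μ t) h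
    simp only [charFun_conv, charFun_gaussianReal] at ht ⊢
    have hexp : Complex.exp (t * (0 : ℝ) * Complex.I - ((v + w : ℝ≥0) : ℝ) * t ^ 2 / 2) =
        Complex.exp (t * (0 : ℝ) * Complex.I - (w : ℝ) * t ^ 2 / 2) *
          Complex.exp (t * (0 : ℝ) * Complex.I - (v : ℝ) * t ^ 2 / 2) := by
      rw [← Complex.exp_add]
      congr 1
      push_cast
      ring
    rw [hexp, ← mul_assoc] at ht
    exact mul_right_cancel₀ (Complex.exp_ne_zero _) ht
  have hw : w = 0 := by
    by_contra hw
    -- all weights of `G` vanish, although `G` has the same positive mass as `G'`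
    have hz : ∀ x, discreteMeasure α θ {x} = 0 := fun x => by
      rw [key]; exact conv_gaussianReal_singleton _ hw x
    have hα0 : ∀ j, α j ≤ 0 := fun j => by
      have h1 := hz (θ j)
      simp only [discreteMeasure, Measure.coe_finsetSum, Finset.sum_apply, Measure.smul_apply,
        smul_eq_mul, Finset.sum_eq_zero_iff, Finset.mem_univ, forall_const] at h1
      simpa using h1 j
    have h0 : discreteMeasure α θ Set.univ = 0 := by
      rw [discreteMeasure_univ hα, ENNReal.ofReal_eq_zero]
      exact Finset.sum_nonpos fun j _ => hα0 j
    have h1 : (discreteMeasure α' θ').conv (gaussianReal 0 w) Set.univ = 1 := by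
      rw [Measure.conv, Measure.map_apply (by fun_prop) MeasurableSet.univ, Set.preimage_univ,
        ← Set.univ_prod_univ, Measure.prod_prod, discreteMeasure_univ hα'.1, hα'.2]
      simp
    rw [← key, h0] at h1
    exact zero_ne_one h1
  subst hw
  exact ⟨rfl, by simpa using key⟩

lemma integral_mixPDF {m : ℕ} {α : Fin m → ℝ} (θ : Fin m → ℝ) {v : ℝ≥0} (hv : v ≠ 0) :
    ∫ x, mixPDF α θ v x = ∑ j, α j := by
  simp only [mixPDF]
  rw [integral_finsetSum _ fun j _ => (integrable_gaussianPDFReal _ _).const_mul _]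
  simp [integral_const_mul, integral_gaussianPDFReal_eq_one _ hv]

lemma integrable_mixPDF {m : ℕ} (α θ : Fin m → ℝ) (v : ℝ≥0) : Integrable (mixPDF α θ v) :=
  integrable_finsetSum _ fun _ _ => (integrable_gaussianPDFReal _ _).const_mul _

/-- Finite normal mixtures with a common variance are identifiable, also when one of the two is
only known to have nonnegative weights. -/
lemma identifiable {m : ℕ} {α θ α' θ' : Fin m → ℝ} (hα : ∀ j, 0 ≤ α j)
    (hα' : α' ∈ stdSimplex ℝ (Fin m)) {v v' : ℝ≥0} (hv : v ≠ 0) (hv' : v' ≠ 0)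
    (h : mixPDF α θ v =ᵐ[volume] mixPDF α' θ' v') :
    v = v' ∧ ∑ j, α j = 1 ∧ discreteMeasure α θ = discreteMeasure α' θ' := by
  have hsum : ∑ j, α j = 1 := by
    rw [← integral_mixPDF θ hv, integral_congr_ae h, integral_mixPDF θ' hv', hα'.2]
  have hconv : (discreteMeasure α θ).conv (gaussianReal 0 v) =
      (discreteMeasure α' θ').conv (gaussianReal 0 v') := by
    rw [discreteMeasure_conv_gaussianReal, discreteMeasure_conv_gaussianReal,
      ← withDensity_mixPDF hα θ hv, ← withDensity_mixPDF hα'.1 θ' hv']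
    exact withDensity_congr_ae (h.mono fun x hx => by simp only [hx])
  rcases le_total v v' with hle | hle
  · obtain ⟨w, rfl⟩ := exists_add_of_le hle
    obtain ⟨rfl, hG⟩ := identifiable_of_le hα hα' hconv
    exact ⟨by simp, hsum, hG⟩
  · obtain ⟨w, rfl⟩ := exists_add_of_le hle
    obtain ⟨rfl, hG⟩ := identifiable_of_le hα'.1 ⟨hα, hsum⟩ hconv.symm
    exact ⟨by simp, hsum, hG.symm⟩

/-! ### Bounds for the log-likelihood -/

lemma gaussianPDFReal_le_of_le_abs {θ x h : ℝ} (hh : 0 ≤ h) (hx : h ≤ |x - θ|) (v : ℝ≥0) :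
    gaussianPDFReal θ v x ≤ (√(2 * Real.pi * v))⁻¹ * Real.exp (-(h ^ 2 / (2 * v))) := by
  unfold gaussianPDFReal
  have : h ^ 2 ≤ (x - θ) ^ 2 := by
    rw [← sq_abs (x - θ)]
    gcongr
  rw [neg_div]
  gcongr

lemma mixPDF_le_of_le_abs {m : ℕ} {α : Fin m → ℝ} (hα : α ∈ stdSimplex ℝ (Fin m))
    {θ : Fin m → ℝ} {x h : ℝ} (hh : 0 ≤ h) (hx : ∀ j, h ≤ |x - θ j|) (v : ℝ≥0) :
    mixPDF α θ v x ≤ (√(2 * Real.pi * v))⁻¹ * Real.exp (-(h ^ 2 / (2 * v))) := by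
  calc mixPDF α θ v x
      ≤ ∑ j, α j * ((√(2 * Real.pi * v))⁻¹ * Real.exp (-(h ^ 2 / (2 * v)))) :=
        Finset.sum_le_sum fun j _ =>
          mul_le_mul_of_nonneg_left (gaussianPDFReal_le_of_le_abs hh (hx j) v) (hα.1 j)
    _ = _ := by rw [← Finset.sum_mul, hα.2, one_mul]

lemma mixPDF_le {m : ℕ} {α : Fin m → ℝ} (hα : α ∈ stdSimplex ℝ (Fin m)) (θ : Fin m → ℝ)
    (v : ℝ≥0) (x : ℝ) : mixPDF α θ v x ≤ (√(2 * Real.pi * v))⁻¹ := by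
  simpa using mixPDF_le_of_le_abs hα le_rfl (fun j => abs_nonneg (x - θ j)) v

lemma log_mixPDF_le_of_le_abs {m : ℕ} {α : Fin m → ℝ} (hα : α ∈ stdSimplex ℝ (Fin m))
    {θ : Fin m → ℝ} {x h : ℝ} (hh : 0 ≤ h) (hx : ∀ j, h ≤ |x - θ j|) {v : ℝ≥0} (hv : 0 < v) :
    Real.log (mixPDF α θ v x) ≤ -(1 / 2) * Real.log (2 * Real.pi * v) - h ^ 2 / (2 * v) := by
  have hv' : (0 : ℝ) < v := hv
  refine (Real.log_le_log (mixPDF_pos hα θ hv.ne' x) (mixPDF_le_of_le_abs hα hh hx v)).trans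
    (le_of_eq ?_)
  rw [Real.log_mul (by positivity) (by positivity), Real.log_exp, Real.log_inv,
    Real.log_sqrt (by positivity)]
  ring

/-- An upper bound for the log-likelihood in terms of the number of observations that keep a
distance of at least `h` from all component means. -/
lemma sum_log_mixPDF_le {ι : Type*} (t s : Finset ι) (hst : s ⊆ t) {m : ℕ} {α : Fin m → ℝ}
    (hα : α ∈ stdSimplex ℝ (Fin m)) {θ : Fin m → ℝ} {x : ι → ℝ} {h : ℝ} (hh : 0 ≤ h)
    (hx : ∀ i ∈ s, ∀ j, h ≤ |x i - θ j|) {v : ℝ≥0} (hv : 0 < v) :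
    ∑ i ∈ t, Real.log (mixPDF α θ v (x i)) ≤
      t.card * (-(1 / 2) * Real.log (2 * Real.pi * v)) - s.card * (h ^ 2 / (2 * v)) := by
  classical
  have h1 : ∑ i ∈ t, Real.log (mixPDF α θ v (x i)) ≤
      ∑ i ∈ t, (-(1 / 2) * Real.log (2 * Real.pi * v) -
        if i ∈ s then h ^ 2 / (2 * v) else 0) := by
    refine Finset.sum_le_sum fun i _ => ?_
    split_ifs with hi
    · exact log_mixPDF_le_of_le_abs hα hh (hx i hi) hv
    · simpa using log_mixPDF_le_of_le_abs hα le_rfl (fun j => abs_nonneg (x i - θ j)) hv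
  refine h1.trans (le_of_eq ?_)
  rw [Finset.sum_sub_distrib, Finset.sum_const, ← Finset.sum_filter,
    Finset.filter_mem_eq_inter, Finset.inter_eq_right.2 hst, Finset.sum_const]
  simp

/-- The bound `-log(2πv)/2 - c/v` on the average log-likelihood tends to `-∞` both as `v → 0`
and as `v → ∞`. -/
lemma exists_variance_bounds {c : ℝ} (hc : 0 < c) (L : ℝ) :
    ∃ ε Δ : ℝ≥0, 0 < ε ∧ ∀ v : ℝ≥0, 0 < v →
      L ≤ -(1 / 2) * Real.log (2 * Real.pi * v) - c / v → v ∈ Set.Icc ε Δ := by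
  set M : ℝ := max (2 * (-L - (1 + Real.log c) / 2) / c) 1
  have hM : 0 < M := lt_max_of_lt_right one_pos
  refine ⟨Real.toNNReal M⁻¹, Real.toNNReal (Real.exp (-2 * L)),
    Real.toNNReal_pos.2 (inv_pos.2 hM), fun v hv h => ?_⟩
  have hv' : (0 : ℝ) < v := hv
  have hle : (v : ℝ) ≤ 2 * Real.pi * v := by nlinarith [Real.pi_gt_three]
  have hlog : Real.log v ≤ Real.log (2 * Real.pi * v) := Real.log_le_log hv' hle
  constructor
  · rw [Real.toNNReal_le_iff_le_coe]
    refine inv_le_of_inv_le₀ hv' (le_max_of_le_left ?_)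
    -- `log t ≤ t - 1` at `t = c / v` bounds half of `c / v`
    have h1 := Real.log_le_sub_one_of_pos (div_pos hc hv')
    rw [Real.log_div hc.ne' hv'.ne'] at h1
    rw [le_div_iff₀ hc]
    have : (v : ℝ)⁻¹ * c = c / v := by ring
    rw [this]
    linarith
  · refine NNReal.le_toNNReal_of_coe_le ?_
    have : 0 ≤ c / v := by positivity
    refine (Real.log_le_iff_le_exp hv').1 ?_
    linarith

/-! ### Existence of a maximum likelihood estimate -/

lemma tendsto_gaussianPDFReal {ι : Type*} {l : Filter ι} {θ : ι → ℝ} {v : ι → ℝ≥0} {θ₀ : ℝ}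
    {v₀ : ℝ≥0} (hθ : Tendsto θ l (𝓝 θ₀)) (hv : Tendsto v l (𝓝 v₀)) (hv₀ : v₀ ≠ 0) (x : ℝ) :
    Tendsto (fun i => gaussianPDFReal (θ i) (v i) x) l (𝓝 (gaussianPDFReal θ₀ v₀ x)) := by
  unfold gaussianPDFReal
  have hv' : Tendsto (fun i => (v i : ℝ)) l (𝓝 v₀) := NNReal.tendsto_coe.2 hv
  have hpos : (0 : ℝ) < v₀ := NNReal.coe_pos.2 (pos_iff_ne_zero.2 hv₀)
  refine Tendsto.mul (Tendsto.inv₀ (hv'.const_mul _).sqrt (by positivity)) ?_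
  refine (Real.continuous_exp.tendsto _).comp (Tendsto.div ?_ (hv'.const_mul _) (by positivity))
  exact ((tendsto_const_nhds.sub hθ).pow 2).neg

lemma abs_sub_clamp_le {A x : ℝ} (hx : |x| ≤ A) (θ : ℝ) :
    |x - max (-A) (min A θ)| ≤ |x - θ| := by
  obtain ⟨h1, h2⟩ := abs_le.1 hx
  rcases le_total A θ with h | h
  · rw [min_eq_left h, max_eq_right (by linarith), abs_of_nonpos (by linarith),
      abs_of_nonpos (by linarith)]
    linarith
  · rw [min_eq_right h]
    rcases le_total (-A) θ with h' | h'
    · rw [max_eq_right h']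
    · rw [max_eq_left h', abs_of_nonneg (by linarith), abs_of_nonneg (by linarith)]
      linarith

/-- The probability measure `∑ j, α j • δ_{θ j}` for weights in the standard simplex. -/
noncomputable def mixingMeasure {m : ℕ} (α θ : Fin m → ℝ) (hα : α ∈ stdSimplex ℝ (Fin m)) :
    ProbabilityMeasure ℝ :=
  ⟨discreteMeasure α θ, ⟨by rw [discreteMeasure_univ hα.1, hα.2, ENNReal.ofReal_one]⟩⟩

lemma mixingMeasure_mem {m : ℕ} (α θ : Fin m → ℝ) (hα : α ∈ stdSimplex ℝ (Fin m)) :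
    mixingMeasure α θ hα ∈ mixingDistributions m :=
  ⟨α, θ, hα.1, hα.2, rfl⟩

lemma logLikelihood_eq {n m : ℕ} (x : Fin n → ℝ) {α : Fin m → ℝ} (hα : ∀ j, 0 ≤ α j)
    (θ : Fin m → ℝ) {G : ProbabilityMeasure ℝ} (hG : (G : Measure ℝ) = discreteMeasure α θ)
    (v : ℝ≥0) : logLikelihood x G v = ∑ i, Real.log (mixPDF α θ v (x i)) := by
  simp only [logLikelihood, normalMixturePDF_eq_mixPDF hα θ hG]

/-- By pigeonhole, `m` points cannot be close to each of more than `m` separated points. -/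
lemma exists_far_point {n m : ℕ} (hnm : m < n) {x : Fin n → ℝ} (hx : Function.Injective x) :
    ∃ h > 0, ∀ θ : Fin m → ℝ, ∃ i, ∀ j, h ≤ |x i - θ j| := by
  obtain ⟨h, hh, hsep⟩ : ∃ h > 0, ∀ p : Fin n × Fin n, p.1 ≠ p.2 → 2 * h < |x p.1 - x p.2| := by
    have : ∀ p : Fin n × Fin n, ∀ᶠ h in 𝓝[>] (0 : ℝ), p.1 ≠ p.2 → 2 * h < |x p.1 - x p.2| := by
      intro p
      by_cases hp : p.1 = p.2
      · simp [hp]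
      have hpos : 0 < |x p.1 - x p.2| := abs_pos.2 (sub_ne_zero.2 (hx.ne hp))
      have hlim : Tendsto (fun h : ℝ => 2 * h) (𝓝[>] 0) (𝓝 0) := by
        simpa using ((continuous_const_mul (2 : ℝ)).tendsto 0).mono_left nhdsWithin_le_nhds
      exact (hlim.eventually_lt_const hpos).mono fun h hh _ => hh
    obtain ⟨h, h1, h2⟩ := ((eventually_all.2 this).and self_mem_nhdsWithin).exists
    exact ⟨h, h2, h1⟩
  refine ⟨h, hh, fun θ => ?_⟩
  by_contra! hcon
  choose J hJ using hcon
  obtain ⟨i, i', hne, heq⟩ := Fintype.exists_ne_map_eq_of_card_lt J (by simpa using hnm)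
  have h1 := hJ i
  have h2 := hJ i'
  rw [← heq] at h2
  have h3 := abs_sub_le (x i) (θ (J i)) (x i')
  rw [abs_sub_comm (θ (J i))] at h3
  linarith [hsep (i, i') hne]

/-- Means outside the range of the observations may be moved to it, and the variance stays in a
compact subinterval of `(0, ∞)`, so a maximizer is found on a compact set of parameters. -/
lemma exists_isMLE {n m : ℕ} (hm : 0 < m) (hnm : m < n) {x : Fin n → ℝ}
    (hx : Function.Injective x) : ∃ (G : ProbabilityMeasure ℝ) (v : ℝ≥0), IsMLE m x G v := by
  have hn : (0 : ℝ) < n := by exact_mod_cast hm.trans hnm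
  obtain ⟨h, hh, hfar⟩ := exists_far_point hnm hx
  set F : (Fin m → ℝ) × (Fin m → ℝ) × ℝ≥0 → ℝ :=
    fun p => ∑ i, Real.log (mixPDF p.1 p.2.1 p.2.2 (x i)) with hF
  have hα₀ : Pi.single ⟨0, hm⟩ 1 ∈ stdSimplex ℝ (Fin m) := single_mem_stdSimplex ℝ _
  obtain ⟨ε, Δ, hε, hbd⟩ := exists_variance_bounds (c := h ^ 2 / (2 * n)) (by positivity)
    (F (Pi.single ⟨0, hm⟩ 1, 0, 1) / n)
  have hvar : ∀ α ∈ stdSimplex ℝ (Fin m), ∀ θ : Fin m → ℝ, ∀ v : ℝ≥0, 0 < v →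
      F (Pi.single ⟨0, hm⟩ 1, 0, 1) ≤ F (α, θ, v) → v ∈ Set.Icc ε Δ := by
    intro α hα θ v hv hle
    refine hbd v hv ?_
    obtain ⟨i, hi⟩ := hfar θ
    have h1 := sum_log_mixPDF_le Finset.univ {i} (Finset.subset_univ _) hα hh.le
      (fun k hk => by rw [Finset.mem_singleton.1 hk]; exact hi) hv
    rw [div_le_iff₀ hn]
    refine (hle.trans h1).trans (le_of_eq ?_)
    have hv' : (v : ℝ) ≠ 0 := NNReal.coe_ne_zero.2 hv.ne'
    simp only [Finset.card_univ, Fintype.card_fin, Finset.card_singleton, Nat.cast_one]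
    field_simp
  -- any bound for the absolute values of the observations would do
  set A : ℝ := ∑ i, |x i|
  have hxA : ∀ i, |x i| ≤ A := fun i =>
    Finset.single_le_sum (f := fun i => |x i|) (fun _ _ => abs_nonneg _) (Finset.mem_univ i)
  have hA : 0 ≤ A := Finset.sum_nonneg fun _ _ => abs_nonneg _
  set S : Set ((Fin m → ℝ) × (Fin m → ℝ) × ℝ≥0) :=
    stdSimplex ℝ (Fin m) ×ˢ (Set.Icc (fun _ => -A) (fun _ => A) ×ˢ Set.Icc ε Δ)
  have hS : IsCompact S := (isCompact_stdSimplex ℝ _).prod (isCompact_Icc.prod isCompact_Icc)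
  have h0 : (Pi.single ⟨0, hm⟩ 1, 0, 1) ∈ S :=
    ⟨hα₀, ⟨fun _ => by simpa using hA, fun _ => hA⟩, hvar _ hα₀ _ _ one_pos le_rfl⟩
  have hcont : ContinuousOn F S := by
    intro p hp
    have hp0 : p.2.2 ≠ 0 := (hε.trans_le hp.2.2.1).ne'
    refine tendsto_finsetSum _ fun i _ => Tendsto.log ?_ (mixPDF_pos hp.1 _ hp0 _).ne'
    refine tendsto_finsetSum _ fun j _ => Tendsto.mul ?_ (tendsto_gaussianPDFReal ?_ ?_ hp0 _)
    · exact ContinuousAt.continuousWithinAt (by fun_prop)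
    · exact ContinuousAt.continuousWithinAt (by fun_prop)
    · exact ContinuousAt.continuousWithinAt (by fun_prop)
  obtain ⟨⟨α, θ, v⟩, hp, hmax⟩ := hS.exists_isMaxOn ⟨_, h0⟩ hcont
  have hα : α ∈ stdSimplex ℝ (Fin m) := hp.1
  refine ⟨mixingMeasure α θ hα, v, mixingMeasure_mem _ _ _, hε.trans_le hp.2.2.1, ?_⟩
  rintro G' ⟨α', θ', hα', hsum', hG'⟩ v' hv'
  rw [logLikelihood_eq x hα' θ' hG', logLikelihood_eq x hα.1 θ rfl]
  change F (α', θ', v') ≤ F (α, θ, v)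
  rcases le_total (F (Pi.single ⟨0, hm⟩ 1, 0, 1)) (F (α', θ', v')) with hle | hle
  · have hclamp : F (α', θ', v') ≤ F (α', fun j => max (-A) (min A (θ' j)), v') := by
      refine Finset.sum_le_sum fun i _ =>
        Real.log_le_log (mixPDF_pos ⟨hα', hsum'⟩ _ hv'.ne' _) (Finset.sum_le_sum fun j _ =>
          mul_le_mul_of_nonneg_left ?_ (hα' j))
      unfold gaussianPDFReal
      have h2 : (x i - max (-A) (min A (θ' j))) ^ 2 ≤ (x i - θ' j) ^ 2 :=
        sq_le_sq.2 (abs_sub_clamp_le (hxA i) _)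
      simp only [neg_div]
      gcongr
    refine hclamp.trans (hmax ⟨⟨hα', hsum'⟩, ⟨fun j => le_max_left _ _, fun j => ?_⟩,
      hvar _ ⟨hα', hsum'⟩ _ _ hv' hle⟩)
    exact max_le (by linarith) (min_le_left _ _)
  · exact hle.trans (hmax h0)

/-! ### Integrability under a normal mixture -/

/-- The distribution on `ℝ` with Lebesgue density `mixPDF α θ v`. -/
noncomputable def mixLaw {m : ℕ} (α θ : Fin m → ℝ) (v : ℝ≥0) : Measure ℝ :=
  volume.withDensity fun x => ENNReal.ofReal (mixPDF α θ v x)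

lemma isProbabilityMeasure_mixLaw {m : ℕ} {α : Fin m → ℝ} (hα : α ∈ stdSimplex ℝ (Fin m))
    (θ : Fin m → ℝ) {v : ℝ≥0} (hv : v ≠ 0) : IsProbabilityMeasure (mixLaw α θ v) := by
  constructor
  rw [mixLaw, withDensity_mixPDF hα.1 θ hv]
  simp [← ENNReal.ofReal_sum_of_nonneg fun j _ => hα.1 j, hα.2]

lemma mixLaw_le {m : ℕ} {α : Fin m → ℝ} (hα : α ∈ stdSimplex ℝ (Fin m)) (θ : Fin m → ℝ)
    (v : ℝ≥0) {s : Set ℝ} (hs : MeasurableSet s) :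
    mixLaw α θ v s ≤ ENNReal.ofReal (√(2 * Real.pi * v))⁻¹ * volume s := by
  rw [mixLaw, withDensity_apply _ hs, ← setLIntegral_const]
  exact lintegral_mono fun x => ENNReal.ofReal_le_ofReal (mixPDF_le hα θ v x)

lemma integrable_sub_sq_mixLaw {m : ℕ} {α : Fin m → ℝ} (hα : ∀ j, 0 ≤ α j) (θ : Fin m → ℝ)
    {v : ℝ≥0} (hv : v ≠ 0) (b : ℝ) : Integrable (fun x => (x - b) ^ 2) (mixLaw α θ v) := by
  rw [mixLaw, withDensity_mixPDF hα θ hv, integrable_finsetSum_measure]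
  intro j _
  refine Integrable.smul_measure ?_ ENNReal.ofReal_ne_top
  exact ((memLp_id_gaussianReal 2).sub (memLp_const b)).integrable_sq

/-- A single component with positive weight bounds the density from below. -/
lemma exists_le_mixPDF {m : ℕ} {α : Fin m → ℝ} (hα : α ∈ stdSimplex ℝ (Fin m)) (θ : Fin m → ℝ)
    {v : ℝ≥0} (hv : v ≠ 0) :
    ∃ c > 0, ∃ b : ℝ, ∀ x, c * Real.exp (-((x - b) ^ 2 / (2 * v))) ≤ mixPDF α θ v x := by
  obtain ⟨j, -, hj⟩ : ∃ j ∈ Finset.univ, (0 : ℝ) < α j :=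
    Finset.exists_lt_of_sum_lt (by simp [hα.2])
  have hv' : (0 : ℝ) < v := NNReal.coe_pos.2 (pos_iff_ne_zero.2 hv)
  refine ⟨α j * (√(2 * Real.pi * v))⁻¹, by positivity, θ j, fun x => ?_⟩
  refine le_trans (le_of_eq ?_) (Finset.single_le_sum
    (f := fun j => α j * gaussianPDFReal (θ j) v x)
    (fun j _ => mul_nonneg (hα.1 j) (gaussianPDFReal_nonneg _ _ _)) (Finset.mem_univ j))
  simp only [gaussianPDFReal, neg_div, mul_assoc]

lemma log_one_add_div_le {C c s y : ℝ} (hC : 0 ≤ C) (hc : 0 < c) (hs : 0 ≤ s)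
    (hy : c * Real.exp (-s) ≤ y) : Real.log (1 + C / y) ≤ Real.log (1 + C / c) + s := by
  have hy0 : 0 < y := lt_of_lt_of_le (mul_pos hc (Real.exp_pos _)) hy
  have h0 : 0 ≤ C / y := div_nonneg hC hy0.le
  have h5 : 0 < 1 + C / c := by positivity
  have h2 : C / y ≤ C / c * Real.exp s := by
    refine (div_le_div_of_nonneg_left hC (by positivity) hy).trans (le_of_eq ?_)
    rw [Real.exp_neg, div_mul_eq_div_div, div_inv_eq_mul]
  have h4 : 1 ≤ Real.exp s := Real.one_le_exp hs
  rw [← Real.log_exp s, ← Real.log_mul h5.ne' (Real.exp_ne_zero _)]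
  exact Real.log_le_log (by linarith) (by linarith)

/-- The envelope `log (1 + C / f)` is integrable under `f`, because `f` decays at most like a
normal density and has a second moment. -/
lemma integrable_log_one_add_div_mixPDF {m : ℕ} {α : Fin m → ℝ}
    (hα : α ∈ stdSimplex ℝ (Fin m)) (θ : Fin m → ℝ) {v : ℝ≥0} (hv : v ≠ 0) {C : ℝ} (hC : 0 ≤ C) :
    Integrable (fun x => Real.log (1 + C / mixPDF α θ v x)) (mixLaw α θ v) := by
  have := isProbabilityMeasure_mixLaw hα θ hv
  obtain ⟨c, hc, b, hle⟩ := exists_le_mixPDF hα θ hv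
  have hpos := mixPDF_pos hα θ hv
  have hmeas : Measurable fun x => Real.log (1 + C / mixPDF α θ v x) :=
    Real.measurable_log.comp ((measurable_const.div
      (continuous_mixPDF α θ v).measurable).const_add 1)
  have hdom : Integrable (fun x => Real.log (1 + C / c) + (x - b) ^ 2 / (2 * v))
      (mixLaw α θ v) :=
    (integrable_const _).add ((integrable_sub_sq_mixLaw hα.1 θ hv b).div_const _)
  refine hdom.mono' hmeas.aestronglyMeasurable (ae_of_all _ fun x => ?_)
  have h0 : 0 ≤ C / mixPDF α θ v x := div_nonneg hC (hpos x).le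
  rw [Real.norm_of_nonneg (Real.log_nonneg (by linarith))]
  exact log_one_add_div_le hC hc (by positivity) (hle x)

lemma integrable_log_mixPDF {m : ℕ} {α : Fin m → ℝ}
    (hα : α ∈ stdSimplex ℝ (Fin m)) (θ : Fin m → ℝ) {v : ℝ≥0} (hv : v ≠ 0) :
    Integrable (fun x => Real.log (mixPDF α θ v x)) (mixLaw α θ v) := by
  have := isProbabilityMeasure_mixLaw hα θ hv
  have hv' : (0 : ℝ) < v := NNReal.coe_pos.2 (pos_iff_ne_zero.2 hv)
  set K := (√(2 * Real.pi * v))⁻¹ with hK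
  have hK0 : 0 < K := by positivity
  -- `|log f| ≤ |log K| + log (1 + K / f)` for `f ≤ K`
  refine Integrable.mono' ((integrable_const |Real.log K|).add
    (integrable_log_one_add_div_mixPDF hα θ hv hK0.le)) ?_ ?_
  · exact (Real.measurable_log.comp (continuous_mixPDF α θ v).measurable).aestronglyMeasurable
  · refine ae_of_all _ fun x => ?_
    have hpos := mixPDF_pos hα θ hv x
    have h1 : Real.log (mixPDF α θ v x) ≤ Real.log K := Real.log_le_log hpos (mixPDF_le hα θ v x)
    have h2 : Real.log (K / mixPDF α θ v x) ≤ Real.log (1 + K / mixPDF α θ v x) :=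
      Real.log_le_log (by positivity) (by linarith)
    have h3 : 0 ≤ Real.log (1 + K / mixPDF α θ v x) :=
      Real.log_nonneg (by linarith [div_pos hK0 hpos])
    rw [Real.log_div hK0.ne' hpos.ne'] at h2
    rw [Real.norm_eq_abs, Pi.add_apply, abs_le]
    constructor <;> linarith [le_abs_self (Real.log K), neg_abs_le (Real.log K)]

/-! ### Strong laws for the sample -/

section Sample

variable {Ω : Type*} [MeasurableSpace Ω] {P : Measure Ω} {X : ℕ → Ω → ℝ} {μ : Measure ℝ}

lemma ae_tendsto_average (hindep : iIndepFun X P) (hlaw : ∀ i, HasLaw (X i) μ P) {F : ℝ → ℝ}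
    (hF : Measurable F) (hint : Integrable F μ) :
    ∀ᵐ ω ∂P, Tendsto (fun n : ℕ => (∑ i ∈ Finset.range n, F (X i ω)) / n) atTop
      (𝓝 (∫ x, F x ∂μ)) := by
  have hae := fun i => (hlaw i).aemeasurable
  have h0 : Integrable (fun ω => F (X 0 ω)) P := by
    rw [← (hlaw 0).map_eq] at hint
    exact hint.comp_aemeasurable (hae 0)
  have h := strong_law_ae_real (fun i ω => F (X i ω)) h0
    (fun i j hij => (hindep.indepFun hij).comp hF hF)
    (fun i => IdentDistrib.comp ⟨hae i, hae 0, by rw [(hlaw i).map_eq, (hlaw 0).map_eq]⟩ hF)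
  have hE : ∫ ω, F (X 0 ω) ∂P = ∫ x, F x ∂μ :=
    (hlaw 0).integral_comp hF.aestronglyMeasurable
  rwa [hE] at h

lemma ae_injective [IsProbabilityMeasure P] (hindep : iIndepFun X P)
    (hlaw : ∀ i, HasLaw (X i) μ P) (hμ : ∀ x, μ {x} = 0) :
    ∀ᵐ ω ∂P, Function.Injective fun i => X i ω := by
  have hpair : ∀ i j, i ≠ j → ∀ᵐ ω ∂P, X i ω ≠ X j ω := by
    intro i j hij
    have : IsProbabilityMeasure μ := (hlaw 0).isProbabilityMeasure_iff.1 inferInstance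
    have hmap := (indepFun_iff_map_prod_eq_prod_map_map (hlaw i).aemeasurable
      (hlaw j).aemeasurable).1 (hindep.indepFun hij)
    rw [(hlaw i).map_eq, (hlaw j).map_eq] at hmap
    have hdiag : (μ.prod μ) {p | p.1 = p.2} = 0 := by
      rw [Measure.measure_prod_null (measurableSet_eq_fun measurable_fst measurable_snd)]
      refine ae_of_all _ fun x => ?_
      have : Prod.mk x ⁻¹' {p : ℝ × ℝ | p.1 = p.2} = {x} := by
        ext y
        exact eq_comm
      simp only [this, hμ, Pi.zero_apply]
    rw [← hmap, Measure.map_apply_of_aemeasurable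
      ((hlaw i).aemeasurable.prodMk (hlaw j).aemeasurable)
      (measurableSet_eq_fun measurable_fst measurable_snd)] at hdiag
    rw [ae_iff]
    simpa using hdiag
  have hall : ∀ᵐ ω ∂P, ∀ i j, i ≠ j → X i ω ≠ X j ω := by
    simp only [ae_all_iff]
    exact hpair
  exact hall.mono fun ω hω i j => not_imp_not.1 (hω i j)

lemma ae_eventually_count_le [IsFiniteMeasure μ] (hindep : iIndepFun X P)
    (hlaw : ∀ i, HasLaw (X i) μ P)
    {S : Set ℝ} (hS : MeasurableSet S) {η : ℝ} (hη : μ.real S < η) :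
    ∀ᵐ ω ∂P, ∀ᶠ n : ℕ in atTop, ∀ p : ℕ → Prop, ∀ [DecidablePred p], (∀ i, p i → X i ω ∈ S) →
      (((Finset.range n).filter p).card : ℝ) ≤ η * n := by
  classical
  have h := ae_tendsto_average hindep hlaw (F := S.indicator fun _ => 1)
    (measurable_const.indicator hS) ((integrable_const _).indicator hS)
  rw [integral_indicator_const _ hS, smul_eq_mul, mul_one] at h
  filter_upwards [h] with ω hω
  filter_upwards [hω.eventually_lt_const hη, eventually_gt_atTop 0] with n hn hn0 p _ hp
  rw [div_lt_iff₀ (by exact_mod_cast hn0)] at hn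
  refine le_trans ?_ hn.le
  rw [Finset.card_filter]
  push_cast
  refine Finset.sum_le_sum fun i _ => ?_
  split_ifs with hi
  · rw [Set.indicator_of_mem (hp i hi)]
  · exact Set.indicator_nonneg (fun _ _ => zero_le_one) _

/-- For a law with bounded density, eventually no cell of a fine enough grid contains more than a
small fraction of the observations; this is uniform over the infinitely many cells, because all but
finitely many of them lie in a tail of small probability. -/
lemma exists_grid_count_le [IsFiniteMeasure μ] (hindep : iIndepFun X P)
    (hlaw : ∀ i, HasLaw (X i) μ P) {C : ℝ} (hC : 0 ≤ C)
    (hμ : ∀ s, MeasurableSet s → μ s ≤ ENNReal.ofReal C * volume s) {η : ℝ} (hη : 0 < η) :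
    ∃ h > 0, ∀ᵐ ω ∂P, ∀ᶠ n : ℕ in atTop, ∀ k : ℤ,
      (((Finset.range n).filter fun i => ⌊X i ω / h⌋ = k).card : ℝ) ≤ η * n := by
  -- a cell has probability at most `C * h < η`
  set h : ℝ := η / (C + 1)
  have hh : 0 < h := by positivity
  refine ⟨h, hh, ?_⟩
  have hmeas : Measurable fun x : ℝ => ⌊x / h⌋ := by fun_prop
  have hcell : ∀ k : ℤ, μ.real {x : ℝ | ⌊x / h⌋ = k} < η := by
    intro k
    have hset : {x : ℝ | ⌊x / h⌋ = k} ⊆ Set.Icc (k * h) ((k + 1) * h) := by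
      intro x hx
      obtain ⟨h1, h2⟩ := Int.floor_eq_iff.1 hx
      rw [le_div_iff₀ hh] at h1
      rw [div_lt_iff₀ hh] at h2
      exact ⟨h1, h2.le⟩
    have h1 : μ.real {x : ℝ | ⌊x / h⌋ = k} ≤ C * h := by
      refine ENNReal.toReal_le_of_le_ofReal (by positivity) ?_
      refine (measure_mono hset).trans ((hμ _ measurableSet_Icc).trans (le_of_eq ?_))
      rw [Real.volume_Icc, ← ENNReal.ofReal_mul hC]
      congr 1
      ring
    refine h1.trans_lt ?_
    rw [mul_div_assoc', div_lt_iff₀ (by positivity)]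
    nlinarith
  obtain ⟨N, hN⟩ : ∃ N : ℕ, μ.real {x | (N : ℤ) < |⌊x / h⌋|} < η := by
    have hanti : Antitone fun N : ℕ => {x : ℝ | (N : ℤ) < |⌊x / h⌋|} := fun N M hNM x hx =>
      lt_of_le_of_lt (Nat.cast_le.2 hNM) (Set.mem_ofPred_eq ▸ hx)
    have hlim := tendsto_measure_iInter_atTop (μ := μ)
      (s := fun N : ℕ => {x : ℝ | (N : ℤ) < |⌊x / h⌋|})
      (fun N => (hmeas (MeasurableSet.of_discrete
        (s := {k : ℤ | (N : ℤ) < |k|}))).nullMeasurableSet)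
      hanti ⟨0, measure_ne_top _ _⟩
    have hempty : ⋂ N : ℕ, {x : ℝ | (N : ℤ) < |⌊x / h⌋|} = ∅ := by
      refine Set.eq_empty_of_forall_notMem fun x hx => ?_
      have := Set.mem_iInter.1 hx |⌊x / h⌋|.toNat
      simp only [Set.mem_ofPred_eq, Int.toNat_of_nonneg (abs_nonneg ⌊x / h⌋), lt_irrefl] at this
    rw [hempty, measure_empty] at hlim
    obtain ⟨N, hN⟩ := (hlim.eventually_lt_const (ENNReal.ofReal_pos.2 hη)).exists
    exact ⟨N, (ENNReal.lt_ofReal_iff_toReal_lt (measure_ne_top _ _)).1 hN⟩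
  have h1 := ae_eventually_count_le hindep hlaw
    (hmeas (MeasurableSet.of_discrete (s := {k : ℤ | (N : ℤ) < |k|}))) hN
  have h2 : ∀ᵐ ω ∂P, ∀ k : ℤ, _ := ae_all_iff.2 fun k =>
    ae_eventually_count_le hindep hlaw (hmeas (measurableSet_singleton k)) (hcell k)
  filter_upwards [h1, h2] with ω hω1 hω2
  have hfin : ∀ᶠ n : ℕ in atTop, ∀ k ∈ Finset.Icc (-N : ℤ) N, _ :=
    (Finset.eventually_all _).2 fun k _ => hω2 k
  filter_upwards [hω1, hfin] with n hn1 hn2 k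
  by_cases hk : |k| ≤ N
  · exact hn2 k (Finset.mem_Icc.2 (abs_le.1 hk)) _ fun i hi => hi
  · exact hn1 _ fun i hi => by
      rw [Set.mem_preimage, hi]
      exact not_le.1 hk

end Sample

/-! ### Bounds for the estimated variance -/

/-- At most half of the observations lie in the few grid cells around the component means, so the
log-likelihood at a too small (or too large) variance is below that at the truth. -/
lemma ae_eventually_variance_mem_Icc {Ω : Type*} [MeasurableSpace Ω] {P : Measure Ω}
    {X : ℕ → Ω → ℝ} {m : ℕ} (hm : 0 < m) {α₀ : Fin m → ℝ} (hα₀ : α₀ ∈ stdSimplex ℝ (Fin m))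
    (θ₀ : Fin m → ℝ) {v₀ : ℝ≥0} (hv₀ : v₀ ≠ 0) (hindep : iIndepFun X P)
    (hlaw : ∀ i, HasLaw (X i) (mixLaw α₀ θ₀ v₀) P) :
    ∃ ε Δ : ℝ≥0, 0 < ε ∧ ∀ᵐ ω ∂P, ∀ᶠ n : ℕ in atTop, ∀ α ∈ stdSimplex ℝ (Fin m),
      ∀ (θ : Fin m → ℝ) (v : ℝ≥0), 0 < v →
        ∑ i ∈ Finset.range n, Real.log (mixPDF α₀ θ₀ v₀ (X i ω)) ≤
          ∑ i ∈ Finset.range n, Real.log (mixPDF α θ v (X i ω)) → v ∈ Set.Icc ε Δ := by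
  have := isProbabilityMeasure_mixLaw hα₀ θ₀ hv₀
  have hm' : (0 : ℝ) < m := by exact_mod_cast hm
  obtain ⟨h, hh, hgrid⟩ := exists_grid_count_le hindep hlaw (by positivity)
    -- each mean `θ j` has only three cells near it, so `3 * m * η = 1 / 2` bounds the bad fraction
    (fun s hs => mixLaw_le hα₀ θ₀ v₀ hs) (η := 1 / (6 * m)) (by positivity)
  set E : ℝ := ∫ x, Real.log (mixPDF α₀ θ₀ v₀ x) ∂(mixLaw α₀ θ₀ v₀)
  obtain ⟨ε, Δ, hε, hbd⟩ := exists_variance_bounds (c := h ^ 2 / 4) (by positivity) (E - 1)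
  refine ⟨ε, Δ, hε, ?_⟩
  have havg := ae_tendsto_average hindep hlaw
    (Real.measurable_log.comp (continuous_mixPDF α₀ θ₀ v₀).measurable)
    (integrable_log_mixPDF hα₀ θ₀ hv₀)
  filter_upwards [hgrid, havg] with ω hω1 hω2
  filter_upwards [hω1, hω2.eventually_const_lt (sub_one_lt E), eventually_gt_atTop 0]
    with n hn1 hn2 hn0 α hα θ v hv hle
  classical
  have hn : (0 : ℝ) < n := by exact_mod_cast hn0
  refine hbd v hv ?_
  set s := (Finset.range n).filter fun i => ∀ j, h ≤ |X i ω - θ j| with hs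
  have hbad : (((Finset.range n).filter fun i => ¬ ∀ j, h ≤ |X i ω - θ j|).card : ℝ) ≤ n / 2 := by
    have hsub : ((Finset.range n).filter fun i => ¬ ∀ j, h ≤ |X i ω - θ j|) ⊆
        Finset.univ.biUnion fun j : Fin m =>
          (Finset.Icc (⌊θ j / h⌋ - 1) (⌊θ j / h⌋ + 1)).biUnion fun k =>
            (Finset.range n).filter fun i => ⌊X i ω / h⌋ = k := by
      intro i hi
      simp only [Finset.mem_filter, not_forall, not_le] at hi
      obtain ⟨hin, j, hj⟩ := hi
      obtain ⟨h1, h2⟩ := abs_lt.1 hj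
      simp only [Finset.mem_biUnion, Finset.mem_univ, true_and, Finset.mem_filter, hin,
        exists_eq_right', Finset.mem_Icc]
      refine ⟨j, ?_, ?_⟩
      · rw [← Int.floor_sub_one]
        refine Int.floor_le_floor ?_
        rw [div_sub_one hh.ne']
        gcongr
        linarith
      · rw [← Int.floor_add_one]
        refine Int.floor_le_floor ?_
        rw [div_add_one hh.ne']
        gcongr
        linarith
    have hcell : ∀ j : Fin m, ((((Finset.Icc (⌊θ j / h⌋ - 1) (⌊θ j / h⌋ + 1)).biUnion fun k =>
        (Finset.range n).filter fun i => ⌊X i ω / h⌋ = k).card : ℕ) : ℝ) ≤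
          3 * (1 / (6 * m) * n) := by
      intro j
      refine (Nat.cast_le.2 Finset.card_biUnion_le).trans ?_
      push_cast
      refine (Finset.sum_le_card_nsmul _ _ _ fun k _ => hn1 k).trans (le_of_eq ?_)
      have : (⌊θ j / h⌋ + 1 + 1 - (⌊θ j / h⌋ - 1)).toNat = 3 := by omega
      rw [Int.card_Icc, this, nsmul_eq_mul]
      norm_num
    refine (Nat.cast_le.2 ((Finset.card_le_card hsub).trans Finset.card_biUnion_le)).trans ?_
    push_cast
    refine (Finset.sum_le_card_nsmul _ _ _ fun j _ => hcell j).trans (le_of_eq ?_)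
    rw [Finset.card_univ, Fintype.card_fin, nsmul_eq_mul]
    field_simp
    norm_num
  have hcard : (n : ℝ) / 2 ≤ s.card := by
    have := Finset.card_filter_add_card_filter_not (s := Finset.range n)
      (fun i => ∀ j, h ≤ |X i ω - θ j|)
    rw [Finset.card_range] at this
    have h' : (s.card : ℝ) +
      ((Finset.range n).filter fun i => ¬ ∀ j, h ≤ |X i ω - θ j|).card = n := by
      exact_mod_cast this
    linarith
  have hup := sum_log_mixPDF_le (Finset.range n) s (Finset.filter_subset _ _) hα hh.le
    (x := fun i => X i ω) (fun i hi => (Finset.mem_filter.1 hi).2) hv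
  have hv' : (0 : ℝ) < v := hv
  have hq : 0 ≤ h ^ 2 / (2 * v) := by positivity
  have h3 : (n : ℝ) / 2 * (h ^ 2 / (2 * v)) ≤ s.card * (h ^ 2 / (2 * v)) :=
    mul_le_mul_of_nonneg_right hcard hq
  rw [lt_div_iff₀ hn] at hn2
  simp only [Function.comp_apply] at hn2
  rw [Finset.card_range] at hup
  refine le_of_mul_le_mul_right ?_ hn
  have h4 : (n : ℝ) / 2 * (h ^ 2 / (2 * v)) = h ^ 2 / 4 / v * n := by
    field_simp
    norm_num
  rw [h4] at h3
  linarith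

/-! ### Compactification of the parameter space -/

/-- The weights of the component means in `[-∞, ∞]` that are finite: the mass at `±∞` is lost. -/
noncomputable def properWeights {m : ℕ} (α : Fin m → ℝ) (e : Fin m → EReal) (j : Fin m) : ℝ :=
  open Classical in if e j = ⊥ ∨ e j = ⊤ then 0 else α j

lemma properWeights_nonneg {m : ℕ} {α : Fin m → ℝ} (hα : ∀ j, 0 ≤ α j) (e : Fin m → EReal)
    (j : Fin m) : 0 ≤ properWeights α e j := by
  unfold properWeights
  split_ifs
  · exact le_rfl
  · exact hα j

lemma properWeights_le {m : ℕ} {α : Fin m → ℝ} (hα : ∀ j, 0 ≤ α j) (e : Fin m → EReal)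
    (j : Fin m) : properWeights α e j ≤ α j := by
  unfold properWeights
  split_ifs
  · exact hα j
  · exact le_rfl

lemma tendsto_gaussianPDFReal_zero {ι : Type*} {l : Filter ι} {θ : ι → ℝ} {v : ι → ℝ≥0}
    {v₀ : ℝ≥0} (hθ : Tendsto (fun i => |θ i|) l atTop) (hv : Tendsto v l (𝓝 v₀)) (hv₀ : v₀ ≠ 0)
    (x : ℝ) : Tendsto (fun i => gaussianPDFReal (θ i) (v i) x) l (𝓝 0) := by
  have hv' : Tendsto (fun i => (v i : ℝ)) l (𝓝 v₀) := NNReal.tendsto_coe.2 hv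
  have hpos : (0 : ℝ) < v₀ := NNReal.coe_pos.2 (pos_iff_ne_zero.2 hv₀)
  have h1 : Tendsto (fun i => (√(2 * Real.pi * v i))⁻¹) l (𝓝 (√(2 * Real.pi * v₀))⁻¹) :=
    Tendsto.inv₀ (hv'.const_mul _).sqrt (by positivity)
  have h2 : Tendsto (fun i => (x - θ i) ^ 2) l atTop := by
    have h3 : Tendsto (fun i => |x - θ i|) l atTop := by
      refine tendsto_atTop_mono (fun i => ?_) (tendsto_atTop_add_const_right l (-|x|) hθ)
      have := abs_sub_abs_le_abs_sub (θ i) x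
      rw [abs_sub_comm] at this
      linarith
    simpa only [Function.comp_def, sq_abs] using
      (tendsto_pow_atTop (two_ne_zero (α := ℕ))).comp h3
  have h4 : Tendsto (fun i => (x - θ i) ^ 2 * (2 * (v i : ℝ))⁻¹) l atTop :=
    h2.atTop_mul_pos (by positivity) ((hv'.const_mul 2).inv₀ (by positivity))
  have h5 := h1.mul (Real.tendsto_exp_neg_atTop_nhds_zero.comp h4)
  rw [mul_zero] at h5
  refine h5.congr fun i => ?_
  simp only [gaussianPDFReal, Function.comp_apply, neg_mul, div_eq_mul_inv]

/-- The mixture density is continuous in the weights, the means and the variance, even if some of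
the means tend to `±∞`; the mass of these means disappears from the limit. -/
lemma tendsto_mixPDF {m : ℕ} {ι : Type*} {l : Filter ι} {α θ : ι → Fin m → ℝ} {v : ι → ℝ≥0}
    {α₀ : Fin m → ℝ} {e : Fin m → EReal} {v₀ : ℝ≥0} (hα : Tendsto α l (𝓝 α₀))
    (hθ : Tendsto (fun i j => (θ i j : EReal)) l (𝓝 e)) (hv : Tendsto v l (𝓝 v₀)) (hv₀ : v₀ ≠ 0)
    (x : ℝ) : Tendsto (fun i => mixPDF (α i) (θ i) (v i) x) l
      (𝓝 (mixPDF (properWeights α₀ e) (fun j => (e j).toReal) v₀ x)) := by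
  refine tendsto_finsetSum _ fun j _ => ?_
  have hαj := tendsto_pi_nhds.1 hα j
  have hθj := tendsto_pi_nhds.1 hθ j
  unfold properWeights
  induction he : e j with
  | bot =>
    rw [he, EReal.tendsto_coe_nhds_bot_iff] at hθj
    simpa using hαj.mul (tendsto_gaussianPDFReal_zero (tendsto_abs_atBot_atTop.comp hθj) hv hv₀ x)
  | top =>
    rw [he, EReal.tendsto_coe_nhds_top_iff] at hθj
    simpa using hαj.mul (tendsto_gaussianPDFReal_zero (tendsto_abs_atTop_atTop.comp hθj) hv hv₀ x)
  | coe r =>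
    rw [he, EReal.tendsto_coe] at hθj
    simpa [he] using hαj.mul (tendsto_gaussianPDFReal hθj hv hv₀ x)

/-! ### The expected log-ratio -/

/-- Jensen's inequality with its equality case: the expected log-ratio `log ((1 + f / f₀) / 2)`
under `f₀` is negative unless the (sub-)density `f` equals `f₀`. -/
lemma mixPDF_ae_eq_of_integral_log_nonneg {m : ℕ} {α θ α₀ θ₀ : Fin m → ℝ} {v v₀ : ℝ≥0}
    (hα : ∀ j, 0 ≤ α j) (hsum : ∑ j, α j ≤ 1) (hv : v ≠ 0) (hα₀ : α₀ ∈ stdSimplex ℝ (Fin m))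
    (hv₀ : v₀ ≠ 0)
    (h : 0 ≤ ∫ x, Real.log ((1 + mixPDF α θ v x / mixPDF α₀ θ₀ v₀ x) / 2) ∂(mixLaw α₀ θ₀ v₀)) :
    mixPDF α θ v =ᵐ[volume] mixPDF α₀ θ₀ v₀ := by
  have := isProbabilityMeasure_mixLaw hα₀ θ₀ hv₀
  set μ := mixLaw α₀ θ₀ v₀ with hμ
  have hpos := mixPDF_pos hα₀ θ₀ hv₀
  have hmeas₀ := (continuous_mixPDF α₀ θ₀ v₀).measurable
  have hcancel : ∀ x, (ENNReal.ofReal (mixPDF α₀ θ₀ v₀ x)).toReal •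
      (mixPDF α θ v x / mixPDF α₀ θ₀ v₀ x) = mixPDF α θ v x := fun x => by
    rw [ENNReal.toReal_ofReal (hpos x).le, smul_eq_mul, mul_div_cancel₀ _ (hpos x).ne']
  have hratio : Integrable (fun x => mixPDF α θ v x / mixPDF α₀ θ₀ v₀ x) μ := by
    rw [hμ, mixLaw, integrable_withDensity_iff_integrable_smul' hmeas₀.ennreal_ofReal
      (ae_of_all _ fun x => ENNReal.ofReal_lt_top)]
    simpa only [hcancel] using integrable_mixPDF α θ v
  have hratio_le : ∫ x, mixPDF α θ v x / mixPDF α₀ θ₀ v₀ x ∂μ ≤ 1 := by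
    rw [hμ, mixLaw, integral_withDensity_eq_integral_toReal_smul hmeas₀.ennreal_ofReal
      (ae_of_all _ fun x => ENNReal.ofReal_lt_top)]
    simpa only [hcancel, integral_mixPDF θ hv] using hsum
  set y : ℝ → ℝ := fun x => (1 + mixPDF α θ v x / mixPDF α₀ θ₀ v₀ x) / 2 with hy
  have hy_half : ∀ x, 1 / 2 ≤ y x := fun x => by
    have := div_nonneg (mixPDF_nonneg hα θ v x) (hpos x).le
    simp only [hy]
    linarith
  have hy_pos : ∀ x, 0 < y x := fun x => lt_of_lt_of_le (by norm_num) (hy_half x)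
  have hy_int : Integrable y μ := ((integrable_const 1).add hratio).div_const 2
  have hy_le : ∫ x, y x ∂μ ≤ 1 := by
    simp only [hy]
    rw [integral_div, integral_add (integrable_const 1) hratio]
    simp only [integral_const, probReal_univ, smul_eq_mul, mul_one]
    linarith
  have hlog_int : Integrable (fun x => Real.log (y x)) μ := by
    have hdom : Integrable (fun x => y x + Real.log 2) μ := hy_int.add (integrable_const _)
    refine hdom.mono' (Real.measurable_log.comp_aemeasurable
      hy_int.aestronglyMeasurable.aemeasurable).aestronglyMeasurable (ae_of_all _ fun x => ?_)
    have h1 := Real.log_le_sub_one_of_pos (hy_pos x)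
    have h2 : -Real.log 2 ≤ Real.log (y x) := by
      rw [← Real.log_inv]
      exact Real.log_le_log (by norm_num) (by simpa using hy_half x)
    have h3 := Real.log_pos one_lt_two
    rw [Real.norm_eq_abs, abs_le]
    constructor <;> linarith [hy_half x]
  have hdiff_int : Integrable (fun x => y x - 1 - Real.log (y x)) μ :=
    (hy_int.sub (integrable_const 1)).sub hlog_int
  have hdiff_nonneg : ∀ x, 0 ≤ y x - 1 - Real.log (y x) := fun x =>
    sub_nonneg.2 (Real.log_le_sub_one_of_pos (hy_pos x))
  -- `∫ (y - 1 - log y)` is nonnegative, and at most `0` by `∫ y ≤ 1` and the hypothesis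
  have hdiff : ∫ x, y x - 1 - Real.log (y x) ∂μ = 0 := by
    refine le_antisymm ?_ (integral_nonneg hdiff_nonneg)
    have h1 : Integrable (fun x => y x - 1) μ := hy_int.sub (integrable_const 1)
    rw [integral_sub h1 hlog_int, integral_sub hy_int (integrable_const 1)]
    simp only [integral_const, probReal_univ, smul_eq_mul, mul_one]
    linarith
  have hae := (integral_eq_zero_iff_of_nonneg hdiff_nonneg hdiff_int).1 hdiff
  rw [hμ, mixLaw, Filter.EventuallyEq, ae_withDensity_iff hmeas₀.ennreal_ofReal] at hae
  filter_upwards [hae] with x hx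
  have hx0 := hx (ENNReal.ofReal_pos.2 (hpos x)).ne'
  have hy1 : y x = 1 := by
    by_contra hne
    have := Real.log_lt_sub_one_of_pos (hy_pos x) hne
    simp only [Pi.zero_apply] at hx0
    linarith
  have h1 : mixPDF α θ v x / mixPDF α₀ θ₀ v₀ x = 1 := by
    simp only [hy] at hy1
    linarith
  exact (div_eq_one_iff_eq (hpos x).ne').1 h1

/-! ### Continuity of the Kiefer-Wolfowitz distance -/

lemma cdf_discreteMeasure {m : ℕ} {α : Fin m → ℝ} (hα : ∀ j, 0 ≤ α j) (θ : Fin m → ℝ)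
    {G : ProbabilityMeasure ℝ} (hG : (G : Measure ℝ) = discreteMeasure α θ) (x : ℝ) :
    cdf (G : Measure ℝ) x = ∑ j, α j * (Set.Iic x).indicator 1 (θ j) := by
  rw [cdf_eq_real, hG, ← integral_indicator_one measurableSet_Iic, integral_discreteMeasure hα]

lemma integrable_exp_neg_abs : Integrable fun x : ℝ => Real.exp (-|x|) := by
  refine (integrable_inv_one_add_sq.const_mul 2).mono'
    (by fun_prop) (ae_of_all _ fun x => ?_)
  -- `1 + x² ≤ 2 exp |x|`
  have h := Real.quadratic_le_exp_of_nonneg (abs_nonneg x)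
  rw [sq_abs] at h
  rw [Real.norm_of_nonneg (Real.exp_pos _).le, Real.exp_neg, ← div_eq_mul_inv,
    inv_le_comm₀ (Real.exp_pos _) (by positivity), inv_div]
  linarith [abs_nonneg x]

/-- Away from the finitely many limit points, the distribution functions converge; the weights of
the means that escape to `±∞` tend to zero because the limit has total mass one. -/
lemma tendsto_distKW {m : ℕ} {α θ : ℕ → Fin m → ℝ} {α₀ : Fin m → ℝ} {e : Fin m → EReal}
    {G : ℕ → ProbabilityMeasure ℝ} {G₀ : ProbabilityMeasure ℝ}
    (hG : ∀ n, (G n : Measure ℝ) = discreteMeasure (α n) (θ n))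
    (hα : ∀ n, α n ∈ stdSimplex ℝ (Fin m)) (hα₀ : α₀ ∈ stdSimplex ℝ (Fin m))
    (hsum : ∑ j, properWeights α₀ e j = 1)
    (hG₀ : (G₀ : Measure ℝ) = discreteMeasure (properWeights α₀ e) (fun j => (e j).toReal))
    (hαlim : Tendsto α atTop (𝓝 α₀))
    (hθlim : Tendsto (fun n j => (θ n j : EReal)) atTop (𝓝 e)) :
    Tendsto (fun n => distKW (G n) G₀) atTop (𝓝 0) := by
  have hweights : ∀ j, properWeights α₀ e j = α₀ j := by
    have h := (Finset.sum_eq_sum_iff_of_le fun j _ => properWeights_le hα₀.1 e j).1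
      (hsum.trans hα₀.2.symm)
    exact fun j => h j (Finset.mem_univ j)
  have hpt : ∀ᵐ x : ℝ, Tendsto (fun n => cdf (G n : Measure ℝ) x) atTop
      (𝓝 (cdf (G₀ : Measure ℝ) x)) := by
    have hfin : ∀ᵐ x : ℝ, ∀ j, x ≠ (e j).toReal := by
      rw [ae_all_iff]
      exact fun j => Measure.ae_ne volume _
    filter_upwards [hfin] with x hx
    rw [cdf_discreteMeasure (properWeights_nonneg hα₀.1 e) _ hG₀]
    simp only [fun n => cdf_discreteMeasure (hα n).1 (θ n) (hG n) x]
    refine tendsto_finsetSum _ fun j _ => ?_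
    have hαj := tendsto_pi_nhds.1 hαlim j
    have hθj := tendsto_pi_nhds.1 hθlim j
    by_cases he : e j = ⊥ ∨ e j = ⊤
    · have h0 : properWeights α₀ e j = 0 := if_pos he
      rw [← hweights j, h0] at hαj
      rw [h0, zero_mul]
      refine squeeze_zero (fun n => mul_nonneg ((hα n).1 j)
        (Set.indicator_nonneg (fun _ _ => zero_le_one) _)) (fun n => ?_) hαj
      exact mul_le_of_le_one_right ((hα n).1 j)
        (Set.indicator_le_self' (f := 1) (fun _ _ => zero_le_one) _)
    · rw [hweights j]
      obtain ⟨hbot, htop⟩ := not_or.1 he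
      rw [← EReal.coe_toReal htop hbot, EReal.tendsto_coe] at hθj
      refine hαj.mul (tendsto_const_nhds.congr' ?_)
      rcases lt_or_gt_of_ne (hx j) with hlt | hgt
      · filter_upwards [hθj.eventually_const_lt hlt] with n hn
        rw [Set.indicator_of_notMem (by simpa using hlt),
          Set.indicator_of_notMem (by simpa using hn)]
      · filter_upwards [hθj.eventually_lt_const hgt] with n hn
        rw [Set.indicator_of_mem (by simpa using hgt.le),
          Set.indicator_of_mem (by simpa using hn.le)]
        rfl
  unfold distKW
  rw [← integral_zero ℝ ℝ (μ := volume)]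
  refine tendsto_integral_of_dominated_convergence (fun x => Real.exp (-|x|)) (fun n => ?_)
    integrable_exp_neg_abs (fun n => ae_of_all _ fun x => ?_) ?_
  · exact ((((cdf _).mono.measurable.sub (cdf _).mono.measurable).abs).mul
      (by fun_prop)).aestronglyMeasurable
  · rw [norm_mul, Real.norm_eq_abs, abs_abs, Real.norm_of_nonneg (Real.exp_pos _).le]
    refine mul_le_of_le_one_left (Real.exp_pos _).le (abs_le.2 ⟨?_, ?_⟩) <;>
    linarith [cdf_nonneg (G n : Measure ℝ) x, cdf_le_one (G n : Measure ℝ) x,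
      cdf_nonneg (G₀ : Measure ℝ) x, cdf_le_one (G₀ : Measure ℝ) x]
  · filter_upwards [hpt] with x hx
    simpa using ((hx.sub_const (cdf (G₀ : Measure ℝ) x)).abs).mul_const (Real.exp (-|x|))

/-! ### Wald's argument -/

/-- A limit along a map `ι` into `K` is also the limit of the suprema over shrinking neighbourhoods
in `K`. -/
lemma tendsto_iSup_preimage {T K : Type*} [TopologicalSpace K] {ι : T → K} {t₀ : K}
    {B : ℕ → Set K} (hB : (𝓝 t₀).HasAntitoneBasis B) (hne : ∀ k, (ι ⁻¹' B k).Nonempty)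
    {g : T → ℝ} {y : ℝ} (hg : Tendsto g (comap ι (𝓝 t₀)) (𝓝 y)) :
    Tendsto (fun k => ⨆ t : ι ⁻¹' B k, g t) atTop (𝓝 y) := by
  rw [Metric.tendsto_atTop]
  intro δ hδ
  have hmem : ∀ᶠ t in comap ι (𝓝 t₀), g t ∈ Metric.closedBall y (δ / 2) :=
    hg.eventually (Metric.closedBall_mem_nhds y (half_pos hδ))
  obtain ⟨k₀, -, hk₀⟩ := (hB.1.comap ι).eventually_iff.1 hmem
  refine ⟨k₀, fun k hk => ?_⟩
  have hball : ∀ t : ι ⁻¹' B k, y - δ / 2 ≤ g t ∧ g t ≤ y + δ / 2 := fun t => by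
    have h := hk₀ (hB.2 hk t.2)
    rw [Metric.mem_closedBall, Real.dist_eq, abs_le] at h
    constructor <;> linarith [h.1, h.2]
  obtain ⟨t, ht⟩ := hne k
  have : Nonempty (ι ⁻¹' B k) := ⟨⟨t, ht⟩⟩
  have hbdd : BddAbove (Set.range fun t : ι ⁻¹' B k => g t) :=
    ⟨y + δ / 2, by rintro _ ⟨t, rfl⟩; exact (hball t).2⟩
  have h1 : ⨆ t : ι ⁻¹' B k, g t ≤ y + δ / 2 := ciSup_le fun t => (hball t).2
  have h2 : y - δ / 2 ≤ ⨆ t : ι ⁻¹' B k, g t :=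
    (hball ⟨t, ht⟩).1.trans (le_ciSup hbdd ⟨t, ht⟩)
  rw [Real.dist_eq, abs_lt]
  constructor <;> linarith

/-- **Wald's argument.** Let `g t` be criterion functions with an integrable envelope, whose
parameters `t` are mapped to a second countable space `K`. Almost surely, if `t n` have nonnegative
criterion averages and converge in `K`, then the criterion in the limit has nonnegative
expectation. The law of large numbers is applied to the suprema of the criterion over the sets of a
countable basis of `K`. -/
lemma ae_integral_nonneg_of_tendsto {Ω : Type*} [MeasurableSpace Ω] {P : Measure Ω}
    {X : ℕ → Ω → ℝ} {μ : Measure ℝ} (hindep : iIndepFun X P) (hlaw : ∀ i, HasLaw (X i) μ P)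
    {T K : Type*} [TopologicalSpace K] [SecondCountableTopology K] (ι : T → K) {g : T → ℝ → ℝ}
    (hg : ∀ t, Continuous (g t)) {H : ℝ → ℝ} (hH : Integrable H μ) (hle : ∀ t x, |g t x| ≤ H x) :
    ∀ᵐ ω ∂P, ∀ (t : ℕ → T) (φ : ℕ → ℕ), Tendsto φ atTop atTop →
      (∀ n, 0 ≤ ∑ i ∈ Finset.range (φ n), g (t n) (X i ω)) →
      ∀ (t₀ : K) (g₀ : ℝ → ℝ), Tendsto (fun n => ι (t n)) atTop (𝓝 t₀) →
        (∀ x, Tendsto (fun s => g s x) (comap ι (𝓝 t₀)) (𝓝 (g₀ x))) → 0 ≤ ∫ x, g₀ x ∂μ := by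
  rcases isEmpty_or_nonempty T with hT | ⟨⟨t'⟩⟩
  · exact ae_of_all _ fun ω t => (hT.false (t 0)).elim
  have hbdd : ∀ (B : Set K) x, BddAbove (Set.range fun s : ι ⁻¹' B => g s x) := fun B x =>
    ⟨H x, by rintro _ ⟨s, rfl⟩; exact (le_abs_self _).trans (hle s x)⟩
  have hmeas : ∀ B : Set K, Measurable fun x => ⨆ s : ι ⁻¹' B, g s x := fun B =>
    (lowerSemicontinuous_ciSup (hbdd B) fun s => (hg s).lowerSemicontinuous).measurable
  have hnorm : ∀ (B : Set K) x, ‖⨆ s : ι ⁻¹' B, g s x‖ ≤ H x := by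
    intro B x
    rcases isEmpty_or_nonempty (ι ⁻¹' B) with hB | ⟨⟨s⟩⟩
    · rw [Real.iSup_of_isEmpty, norm_zero]
      exact (abs_nonneg _).trans (hle t' x)
    · rw [Real.norm_eq_abs, abs_le]
      have : Nonempty (ι ⁻¹' B) := ⟨s⟩
      exact ⟨(abs_le.1 (hle s x)).1.trans (le_ciSup (hbdd B x) s),
        ciSup_le fun s => (abs_le.1 (hle s x)).2⟩
  have hslln : ∀ᵐ ω ∂P, ∀ B ∈ TopologicalSpace.countableBasis K,
      Tendsto (fun n : ℕ => (∑ i ∈ Finset.range n, ⨆ s : ι ⁻¹' B, g s (X i ω)) / n) atTop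
        (𝓝 (∫ x, ⨆ s : ι ⁻¹' B, g s x ∂μ)) :=
    (ae_ball_iff (TopologicalSpace.countable_countableBasis K)).2 fun B _ =>
      ae_tendsto_average hindep hlaw (hmeas B)
        (hH.mono' (hmeas B).aestronglyMeasurable (ae_of_all _ (hnorm B)))
  filter_upwards [hslln] with ω hω t φ hφ hnonneg t₀ g₀ ht₀ hg₀
  obtain ⟨B, hBmem, hB⟩ :=
    ((TopologicalSpace.isBasis_countableBasis K).nhds_hasBasis (a := t₀)).exists_antitone_subbasis
  have hev : ∀ k, ∀ᶠ n in atTop, ι (t n) ∈ B k := fun k =>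
    ht₀.eventually_mem (hB.1.mem_of_mem trivial)
  have hBnonneg : ∀ k, 0 ≤ ∫ x, ⨆ s : ι ⁻¹' B k, g s x ∂μ := by
    intro k
    refine ge_of_tendsto ((hω (B k) (hBmem k).1).comp hφ) ((hev k).mono fun n hn => ?_)
    refine div_nonneg ((hnonneg n).trans (Finset.sum_le_sum fun i _ => ?_)) (Nat.cast_nonneg _)
    exact le_ciSup (hbdd (B k) (X i ω)) ⟨t n, hn⟩
  refine ge_of_tendsto' (tendsto_integral_of_dominated_convergence H
    (fun k => (hmeas (B k)).aestronglyMeasurable) hH (fun k => ae_of_all _ (hnorm (B k)))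
    (ae_of_all _ fun x => ?_)) hBnonneg
  exact tendsto_iSup_preimage hB (fun k => let ⟨n, hn⟩ := (hev k).exists; ⟨t n, hn⟩) (hg₀ x)

/-- Concavity of the logarithm at `1` and `a / b`. -/
lemma half_log_sub_le_log {a b : ℝ} (ha : 0 < a) (hb : 0 < b) :
    (Real.log a - Real.log b) / 2 ≤ Real.log ((1 + a / b) / 2) := by
  have hr : 0 < a / b := div_pos ha hb
  have h : Real.log (a / b) ≤ Real.log (((1 + a / b) / 2) ^ 2) :=
    Real.log_le_log hr (by nlinarith [sq_nonneg (1 - a / b)])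
  rw [Real.log_pow, Real.log_div ha.ne' hb.ne'] at h
  push_cast at h
  linarith

/-- Limits, along almost every sample path, of parameters whose likelihood is at least that of the
truth, are equal to the truth. -/
lemma ae_eq_of_tendsto {Ω : Type*} [MeasurableSpace Ω] {P : Measure Ω}
    {X : ℕ → Ω → ℝ} {m : ℕ} {α₀ : Fin m → ℝ} (hα₀ : α₀ ∈ stdSimplex ℝ (Fin m))
    (θ₀ : Fin m → ℝ) {v₀ : ℝ≥0} (hv₀ : v₀ ≠ 0) (hindep : iIndepFun X P)
    (hlaw : ∀ i, HasLaw (X i) (mixLaw α₀ θ₀ v₀) P) {ε Δ : ℝ≥0} (hε : 0 < ε) :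
    ∀ᵐ ω ∂P, ∀ (α θ : ℕ → Fin m → ℝ) (v : ℕ → ℝ≥0) (φ : ℕ → ℕ), Tendsto φ atTop atTop →
      (∀ n, α n ∈ stdSimplex ℝ (Fin m)) → (∀ n, v n ∈ Set.Icc ε Δ) →
      (∀ n, ∑ i ∈ Finset.range (φ n), Real.log (mixPDF α₀ θ₀ v₀ (X i ω)) ≤
        ∑ i ∈ Finset.range (φ n), Real.log (mixPDF (α n) (θ n) (v n) (X i ω))) →
      ∀ (α' : Fin m → ℝ) (e : Fin m → EReal) (v' : ℝ≥0),
        α' ∈ stdSimplex ℝ (Fin m) → v' ∈ Set.Icc ε Δ →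
        Tendsto α atTop (𝓝 α') → Tendsto (fun n j => (θ n j : EReal)) atTop (𝓝 e) →
        Tendsto v atTop (𝓝 v') →
        v' = v₀ ∧ ∑ j, properWeights α' e j = 1 ∧
          discreteMeasure (properWeights α' e) (fun j => (e j).toReal) =
            discreteMeasure α₀ θ₀ := by
  have := isProbabilityMeasure_mixLaw hα₀ θ₀ hv₀
  have hpos := mixPDF_pos hα₀ θ₀ hv₀
  set C : ℝ := (√(2 * Real.pi * ε))⁻¹
  have hε' : (0 : ℝ) < ε := hε
  have hC : 0 < C := by positivity
  let T := {p : (Fin m → ℝ) × (Fin m → ℝ) × ℝ≥0 //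
    p.1 ∈ stdSimplex ℝ (Fin m) ∧ p.2.2 ∈ Set.Icc ε Δ}
  let ι : T → (Fin m → ℝ) × (Fin m → EReal) × ℝ≥0 :=
    fun p => (p.1.1, fun j => (p.1.2.1 j : EReal), p.1.2.2)
  let g : T → ℝ → ℝ := fun p x =>
    Real.log ((1 + mixPDF p.1.1 p.1.2.1 p.1.2.2 x / mixPDF α₀ θ₀ v₀ x) / 2)
  have hTpos : ∀ (p : T) x, 0 < mixPDF p.1.1 p.1.2.1 p.1.2.2 x := fun p x =>
    mixPDF_pos p.2.1 _ (hε.trans_le p.2.2.1).ne' x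
  have hgcont : ∀ p, Continuous (g p) := fun p =>
    Continuous.log ((continuous_const.add ((continuous_mixPDF _ _ _).div (continuous_mixPDF _ _ _)
      fun x => (hpos x).ne')).div_const 2) fun x => by
        have := div_pos (hTpos p x) (hpos x)
        positivity
  have henv : Integrable (fun x => Real.log 2 + Real.log (1 + C / mixPDF α₀ θ₀ v₀ x))
      (mixLaw α₀ θ₀ v₀) :=
    (integrable_const _).add (integrable_log_one_add_div_mixPDF hα₀ θ₀ hv₀ hC.le)
  have hgle : ∀ p x, |g p x| ≤ Real.log 2 + Real.log (1 + C / mixPDF α₀ θ₀ v₀ x) := by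
    intro p x
    have h1 : mixPDF p.1.1 p.1.2.1 p.1.2.2 x ≤ C := by
      refine (mixPDF_le p.2.1 _ _ x).trans ?_
      have : (ε : ℝ) ≤ p.1.2.2 := p.2.2.1
      simp only [C]
      gcongr
    have h2 := div_pos (hTpos p x) (hpos x)
    have h3 : mixPDF p.1.1 p.1.2.1 p.1.2.2 x / mixPDF α₀ θ₀ v₀ x ≤ C / mixPDF α₀ θ₀ v₀ x :=
      div_le_div_of_nonneg_right h1 (hpos x).le
    have h4 : 0 ≤ Real.log (1 + mixPDF p.1.1 p.1.2.1 p.1.2.2 x / mixPDF α₀ θ₀ v₀ x) :=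
      Real.log_nonneg (by linarith)
    have h5 := Real.log_le_log (by linarith : 0 <
      1 + mixPDF p.1.1 p.1.2.1 p.1.2.2 x / mixPDF α₀ θ₀ v₀ x) (add_le_add_right h3 1)
    have h6 := Real.log_pos one_lt_two
    simp only [g]
    rw [Real.log_div (by linarith) two_ne_zero, abs_le]
    constructor <;> linarith
  filter_upwards [ae_integral_nonneg_of_tendsto hindep hlaw ι hgcont henv hgle] with ω hω
    α θ v φ hφ hα hv hlik α' e v' hα' hv' hαlim hθlim hvlim
  have hv'0 : v' ≠ 0 := (hε.trans_le hv'.1).ne'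
  refine identifiable (properWeights_nonneg hα'.1 e) hα₀ hv'0 hv₀ ?_
  refine mixPDF_ae_eq_of_integral_log_nonneg (properWeights_nonneg hα'.1 e)
    ((Finset.sum_le_sum fun j _ => properWeights_le hα'.1 e j).trans hα'.2.le) hv'0 hα₀ hv₀ ?_
  refine hω (fun n => ⟨(α n, θ n, v n), hα n, hv n⟩) φ hφ (fun n => ?_) (α', e, v') _
    (hαlim.prodMk_nhds (hθlim.prodMk_nhds hvlim)) fun x => ?_
  · calc (0 : ℝ) ≤ (∑ i ∈ Finset.range (φ n), Real.log (mixPDF (α n) (θ n) (v n) (X i ω)) -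
          ∑ i ∈ Finset.range (φ n), Real.log (mixPDF α₀ θ₀ v₀ (X i ω))) / 2 := by
            linarith [hlik n]
      _ = ∑ i ∈ Finset.range (φ n), (Real.log (mixPDF (α n) (θ n) (v n) (X i ω)) -
          Real.log (mixPDF α₀ θ₀ v₀ (X i ω))) / 2 := by
            rw [← Finset.sum_sub_distrib, Finset.sum_div]
      _ ≤ _ := Finset.sum_le_sum fun i _ => half_log_sub_le_log
            (hTpos ⟨(α n, θ n, v n), hα n, hv n⟩ _) (hpos _)
  · have hι : Tendsto ι (comap ι (𝓝 (α', e, v'))) (𝓝 (α', e, v')) := tendsto_comap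
    have h := tendsto_mixPDF (θ := fun p : T => p.1.2.1) hι.fst_nhds hι.snd_nhds.fst_nhds
      hι.snd_nhds.snd_nhds hv'0 x
    refine Tendsto.log (((h.div_const _).const_add 1).div_const 2) ?_
    have := div_nonneg (mixPDF_nonneg (properWeights_nonneg hα'.1 e) (fun j => (e j).toReal) v' x)
      (hpos x).le
    positivity

/-! ### Strong consistency -/

theorem mainTheorem6 {Ω : Type*} [MeasurableSpace Ω] (P : Measure Ω) [IsProbabilityMeasure P]
    (m : ℕ) (Gstar : ProbabilityMeasure ℝ) (hGstar : Gstar ∈ mixingDistributions m)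
    (vstar : ℝ≥0) (hvstar : 0 < vstar)
    (X : ℕ → Ω → ℝ) (hindep : iIndepFun X P)
    (hlaw : ∀ i, HasLaw (X i) (normalMixture Gstar vstar) P) :
    (∀ᵐ ω ∂P, ∀ n : ℕ, m < n →
      ∃ (G : ProbabilityMeasure ℝ) (v : ℝ≥0), IsMLE m (fun i : Fin n => X i ω) G v) ∧
    ∀ (Ghat : ℕ → Ω → ProbabilityMeasure ℝ) (vhat : ℕ → Ω → ℝ≥0),
      (∀ᵐ ω ∂P, ∀ᶠ n in atTop, IsMLE m (fun i : Fin n => X i ω) (Ghat n ω) (vhat n ω)) →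
      ∀ᵐ ω ∂P,
        Tendsto (fun n => distKW (Ghat n ω) Gstar) atTop (𝓝 0) ∧
        Tendsto (fun n => vhat n ω) atTop (𝓝 vstar) := by
  obtain ⟨α₀, θ₀, hα₀_nonneg, hα₀_sum, hG₀⟩ := id hGstar
  have hα₀ : α₀ ∈ stdSimplex ℝ (Fin m) := ⟨hα₀_nonneg, hα₀_sum⟩
  have hm : 0 < m := by
    rcases Nat.eq_zero_or_pos m with rfl | hm
    · simp at hα₀_sum
    · exact hm
  have hv₀ : vstar ≠ 0 := hvstar.ne'
  have hmix : normalMixture Gstar vstar = mixLaw α₀ θ₀ vstar := by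
    simp only [normalMixture, mixLaw, normalMixturePDF_eq_mixPDF hα₀_nonneg θ₀ hG₀]
  rw [hmix] at hlaw
  constructor
  · have hatom : ∀ x, mixLaw α₀ θ₀ vstar {x} = 0 := fun x =>
      withDensity_absolutelyContinuous _ _ (measure_singleton x)
    filter_upwards [ae_injective hindep hlaw hatom] with ω hω n hn
    exact exists_isMLE hm hn fun i j hij => Fin.val_injective (hω hij)
  · intro Ghat vhat hMLE
    obtain ⟨ε, Δ, hε, hvar⟩ := ae_eventually_variance_mem_Icc hm hα₀ θ₀ hv₀ hindep hlaw
    filter_upwards [hMLE, hvar, ae_eq_of_tendsto hα₀ θ₀ hv₀ hindep hlaw (Δ := Δ) hε]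
      with ω hω1 hω2 hω3
    have hdata : ∀ᶠ n in atTop, ∃ α θ : Fin m → ℝ, α ∈ stdSimplex ℝ (Fin m) ∧
        (Ghat n ω : Measure ℝ) = discreteMeasure α θ ∧ vhat n ω ∈ Set.Icc ε Δ ∧
        ∑ i ∈ Finset.range n, Real.log (mixPDF α₀ θ₀ vstar (X i ω)) ≤
          ∑ i ∈ Finset.range n, Real.log (mixPDF α θ (vhat n ω) (X i ω)) := by
      filter_upwards [hω1, hω2] with n hn1 hn2
      obtain ⟨⟨α, θ, hα, hsum, hG⟩, hv, hmax⟩ := hn1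
      have hlik := hmax Gstar hGstar vstar hvstar
      rw [logLikelihood_eq _ hα θ hG, logLikelihood_eq _ hα₀_nonneg θ₀ hG₀,
        Fin.sum_univ_eq_sum_range (fun i => Real.log (mixPDF α₀ θ₀ vstar (X i ω))),
        Fin.sum_univ_eq_sum_range (fun i => Real.log (mixPDF α θ (vhat n ω) (X i ω)))] at hlik
      exact ⟨α, θ, ⟨hα, hsum⟩, hG, hn2 α ⟨hα, hsum⟩ θ _ hv hlik, hlik⟩
    -- dropping the first `N` terms makes the parameters available at every index
    obtain ⟨N, hN⟩ := eventually_atTop.1 hdata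
    choose α θ hα hG hv hlik using fun n : ℕ => hN (n + N) (Nat.le_add_left N n)
    suffices h : Tendsto (fun n => (distKW (Ghat (n + N) ω) Gstar, vhat (n + N) ω)) atTop
        (𝓝 (0, vstar)) from
      ⟨(tendsto_add_atTop_iff_nat N).1 h.fst_nhds, (tendsto_add_atTop_iff_nat N).1 h.snd_nhds⟩
    refine tendsto_of_subseq_tendsto fun ns hns => ?_
    have hcompact : IsCompact (stdSimplex ℝ (Fin m) ×ˢ
        ((Set.univ : Set (Fin m → EReal)) ×ˢ Set.Icc ε Δ)) :=
      (isCompact_stdSimplex ℝ _).prod (isCompact_univ.prod isCompact_Icc)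
    obtain ⟨⟨α', e, v'⟩, ⟨hα', -, hv'⟩, φ, hφ, hlim⟩ := hcompact.tendsto_subseq
      (x := fun n => (α (ns n), fun j => (θ (ns n) j : EReal), vhat (ns n + N) ω))
      fun n => ⟨hα _, trivial, hv _⟩
    have hsub : Tendsto (fun n => ns (φ n) + N) atTop atTop :=
      (tendsto_add_atTop_nat N).comp (hns.comp hφ.tendsto_atTop)
    obtain ⟨rfl, hsum, hlimG⟩ := hω3 (fun n => α (ns (φ n))) (fun n => θ (ns (φ n)))
      (fun n => vhat (ns (φ n) + N) ω) (fun n => ns (φ n) + N) hsub (fun n => hα _)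
      (fun n => hv _) (fun n => hlik _) α' e v' hα' hv' hlim.fst_nhds hlim.snd_nhds.fst_nhds
      hlim.snd_nhds.snd_nhds
    exact ⟨φ, (tendsto_distKW (fun n => hG _) (fun n => hα _) hα' hsum (hG₀.trans hlimG.symm)
      hlim.fst_nhds hlim.snd_nhds.fst_nhds).prodMk_nhds hlim.snd_nhds.snd_nhds⟩
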